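/- Let $\mathbf{Set}$ be the category of sets, $\mathbf{Set}_{\mathsf f}$ its full subcategory of finite sets with inclusion $I\colon \mathbf{Set}_{\mathsf f}\hookrightarrow\mathbf{Set}$, and $\mathbf{BA}$ the category of Boolean algebras; write $2=\{0,1\}$ for the two-element set and for the two-element Boolean algebra. The *ultrafilter monad* $\mathcal U$ on $\mathbf{Set}$ is the monad induced by the dual adjunction $$\mathbf{Set}(-,2)\dashv \mathbf{BA}(-,2)\colon \mathbf{BA}^{\mathsf{op}}\to\mathbf{Set},$$ where $\mathbf{Set}(X,2)$ carries the pointwise Boolean algebra structure and the unit and counit are given by evaluation; thus $\mathcal U X=\mathbf{BA}(\mathbf{Set}(X,2),2)$. The *codensity monad* of a functor $F\colon\mathbf A\to\mathbf C$ is the monad $(\mathrm{Ran}_F F,\eta,\mu)$ carried by the right Kan extension of $F$ along itself (if it exists), with counit $\varphi\colon(\mathrm{Ran}_FF)F\to F$, where $\eta\colon\mathrm{Id}\to\mathrm{Ran}_FF$ and $\mu\colon(\mathrm{Ran}_FF)(\mathrm{Ran}_FF)\to\mathrm{Ran}_FF$ are the unique natural transformations with $\varphi\cdot\eta F=\mathrm{id}_F$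 and $\varphi\cdot\mu F=\varphi\cdot(\mathrm{Ran}_FF)\varphi$. **Theorem (Kennison–Gildenhuys).** The ultrafilter monad $\mathcal U$ on $\mathbf{Set}$ is the codensity monad of the inclusion $I\colon\mathbf{Set}_{\mathsf f}\hookrightarrow\mathbf{Set}$. That is, the right Kan extension $\mathrm{Ran}_I I$ exists and is pointwise, i.e. $(\mathrm{Ran}_I I)X=\lim_{f\colon X\to IA}IA$ for every set $X$, with $f$ ranging over all maps from $X$ to finite sets $A$, and $\mathcal U$ is isomorphic, in the category of monads on $\mathbf{Set}$ and monad morphisms, to the codensity monad of $I$. -/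

import Mathlib

open CategoryTheory Opposite

universe u

namespace Codensity

noncomputable section General

universe v₁ v₂ u₁ u₂

variable {A : Type u₁} [Category.{v₁} A] {C : Type u₂} [Category.{v₂} C] (F : A ⥤ C)
  [F.HasRightKanExtension F]

/-- The underlying endofunctor `Ran_F F`. -/
abbrev ran : C ⥤ C := F.rightKanExtension F

/-- The counit `φ : (Ran_F F) F ⟶ F`. -/
abbrev counit : F ⋙ ran F ⟶ F := F.rightKanExtensionCounit F

/-- The unit: the transformation corresponding to `id : F ⟶ F`. -/
def unit : 𝟭 C ⟶ ran F :=
  (ran F).liftOfIsRightKanExtension (counit F) (𝟭 C) F.rightUnitor.hom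

/-- The multiplication: the transformation corresponding to
`(Ran_F F)(Ran_F F) F ⟶ (Ran_F F) F ⟶ F`, the composite of `(Ran_F F) φ` and `φ`. -/
def mult : ran F ⋙ ran F ⟶ ran F :=
  (ran F).liftOfIsRightKanExtension (counit F) (ran F ⋙ ran F)
    ((Functor.associator F (ran F) (ran F)).inv ≫
      Functor.whiskerRight (counit F) (ran F) ≫ counit F)

theorem unit_fac (X : A) : (unit F).app (F.obj X) ≫ (counit F).app X = 𝟙 (F.obj X) := by
  simp [unit]

theorem mult_fac (X : A) : (mult F).app (F.obj X) ≫ (counit F).app X =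
    (ran F).map ((counit F).app X) ≫ (counit F).app X := by
  simp [mult]

theorem ran_hom_ext {G : C ⥤ C} {γ₁ γ₂ : G ⟶ ran F}
    (h : ∀ X : A, γ₁.app (F.obj X) ≫ (counit F).app X = γ₂.app (F.obj X) ≫ (counit F).app X) :
    γ₁ = γ₂ :=
  (ran F).hom_ext_of_isRightKanExtension (counit F) _ _ (by ext X; exact h X)

theorem unit_mult (X : C) : (unit F).app ((ran F).obj X) ≫ (mult F).app X = 𝟙 _ := by
  have h : (Functor.rightUnitor (ran F)).inv ≫ Functor.whiskerLeft (ran F) (unit F) ≫ mult F =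
      𝟙 (ran F) := by
    refine ran_hom_ext F fun Y => ?_
    have := (unit F).naturality ((counit F).app Y)
    simp only [Functor.id_obj, Functor.id_map] at this
    simp only [NatTrans.comp_app, Functor.rightUnitor_inv_app, Functor.whiskerLeft_app,
      Category.assoc, mult_fac, NatTrans.id_app, Category.id_comp]
    erw [← reassoc_of% this, unit_fac, Category.comp_id]
  simpa using NatTrans.congr_app h X

theorem map_unit_mult (X : C) : (ran F).map ((unit F).app X) ≫ (mult F).app X = 𝟙 _ := by
  have h : (Functor.leftUnitor (ran F)).inv ≫ Functor.whiskerRight (unit F) (ran F) ≫ mult F =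
      𝟙 (ran F) := by
    refine ran_hom_ext F fun Y => ?_
    simp only [NatTrans.comp_app, Functor.leftUnitor_inv_app, Functor.whiskerRight_app,
      Category.assoc, mult_fac, NatTrans.id_app, Category.id_comp]
    rw [← Functor.map_comp_assoc, unit_fac]
    simp
  simpa using NatTrans.congr_app h X

theorem mult_assoc (X : C) : (ran F).map ((mult F).app X) ≫ (mult F).app X =
    (mult F).app ((ran F).obj X) ≫ (mult F).app X := by
  have h : Functor.whiskerRight (mult F) (ran F) ≫ mult F =
      (Functor.associator (ran F) (ran F) (ran F)).hom ≫
        Functor.whiskerLeft (ran F) (mult F) ≫ mult F := by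
    refine ran_hom_ext F fun Y => ?_
    have := (mult F).naturality ((counit F).app Y)
    simp only [Functor.comp_map] at this
    simp only [NatTrans.comp_app, Functor.associator_hom_app, Functor.whiskerRight_app,
      Functor.whiskerLeft_app, Category.assoc, mult_fac, Category.id_comp]
    erw [← reassoc_of% this, ← Functor.map_comp_assoc, mult_fac]
    simp
  simpa using NatTrans.congr_app h X

/-- The codensity monad of `F : A ⥤ C`, defined when the right Kan extension of `F` along itself
exists. -/
def codensityMonad : Monad C where
  toFunctor := ran F
  η := unit F
  μ := mult F
  assoc := mult_assoc F
  left_unit := unit_mult F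
  right_unit := map_unit_mult F

end General

noncomputable section Ultrafilter

/-- The functor `Set(-,2) : Set ⥤ BAᵒᵖ`, where `Set(X,2)` has the pointwise operations. -/
def predicates : Type u ⥤ BoolAlg.{u}ᵒᵖ where
  obj X := op (BoolAlg.of (X → Bool))
  map {X Y} f := Quiver.Hom.op (BoolAlg.ofHom
    { toFun := fun p x => p (f x)
      map_sup' := fun _ _ => rfl
      map_inf' := fun _ _ => rfl
      map_top' := rfl
      map_bot' := rfl } : BoolAlg.of (Y → Bool) ⟶ BoolAlg.of (X → Bool))

/-- The functor `BA(-,2) : BAᵒᵖ ⥤ Set`. The morphisms of the category of Boolean algebras are the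
maps preserving `⊔`, `⊓`, `⊤`, `⊥` (hence complements), that is, `BoundedLatticeHom`. -/
def points : BoolAlg.{u}ᵒᵖ ⥤ Type u where
  obj B := BoundedLatticeHom B.unop Bool
  map f := ↾fun χ => χ.comp f.unop.hom

/-- Evaluation `X → BA(Set(X,2),2)` at points of `X`. -/
def evalPoint (X : Type u) (x : X) : BoundedLatticeHom (X → Bool) Bool where
  toFun p := p x
  map_sup' _ _ := rfl
  map_inf' _ _ := rfl
  map_top' := rfl
  map_bot' := rfl

/-- Evaluation `B → Set(BA(B,2),2)` at elements of the Boolean algebra `B`. -/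
def evalElement (B : BoolAlg.{u}) : BoundedLatticeHom B (BoundedLatticeHom B Bool → Bool) where
  toFun b χ := χ b
  map_sup' _ _ := funext fun χ => map_sup χ _ _
  map_inf' _ _ := funext fun χ => map_inf χ _ _
  map_top' := funext fun χ => map_top χ
  map_bot' := funext fun χ => map_bot χ

/-- The dual adjunction `Set(-,2) ⊣ BA(-,2) : BAᵒᵖ ⥤ Set`. -/
def dualAdjunction : predicates.{u} ⊣ points.{u} :=
  Adjunction.mkOfUnitCounit
    { unit := { app := fun X => ↾(evalPoint X)
                naturality := fun _ _ _ => rfl }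
      counit := { app := fun B => Quiver.Hom.op (BoolAlg.ofHom (evalElement B.unop))
                  naturality := fun _ _ _ => rfl }
      left_triangle := rfl
      right_triangle := rfl }

/-- The ultrafilter monad on `Set`, `X ↦ BA(Set(X,2),2)`, induced by the dual adjunction. -/
def ultrafilterMonad : Monad (Type u) := dualAdjunction.{u}.toMonad

end Ultrafilter

end Codensity

/-!
A compatible choice of a point of `A` for every map from `X` to a finite set `A` is determined by
the truth values it assigns to the predicates `X → 2`. Compatibility with the Boolean operations
`2 × 2 → 2` and `1 → 2` makes this assignment an ultrafilter. Conversely, an ultrafilter on `X`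
pushed forward along `X → A` is principal, since `A` is finite, and so chooses a point of `A`.
Hence `𝒰 X = lim A`, with Kan extension counit the inverse of `η` on finite sets. Compatibility of
this counit with the multiplication is automatic: by the unit law, `μ_A = 𝒰(η_A⁻¹)` whenever `η_A`
is invertible.
-/

namespace Codensity

noncomputable section Recognition

universe v₁ v₂ u₁ u₂

variable {A : Type u₁} [Category.{v₁} A] {C : Type u₂} [Category.{v₂} C]

section Comparison

variable {F : A ⥤ C} [F.HasRightKanExtension F] (T : C ⥤ C) (α : F ⋙ T ⟶ F)
  [T.IsRightKanExtension α]

/-- The canonical isomorphism to `Ran_F F` from an arbitrary right Kan extension `(T, α)` of `F`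
along itself. -/
def ranIso : T ≅ ran F := Functor.rightKanExtensionUnique T α (ran F) (counit F)

theorem ranIso_hom_app_comp_counit (X : A) :
    (ranIso T α).hom.app (F.obj X) ≫ (counit F).app X = α.app X := by
  simp [ranIso]

end Comparison

section Monad

variable {F : A ⥤ C} [F.HasRightKanExtension F] (T : Monad C) (α : F ⋙ (T : C ⥤ C) ⟶ F)
  [(T : C ⥤ C).IsRightKanExtension α]

theorem η_comp_ranIso_hom (hη : ∀ X, T.η.app (F.obj X) ≫ α.app X = 𝟙 (F.obj X)) :
    T.η ≫ (ranIso (T : C ⥤ C) α).hom = unit F := by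
  refine ran_hom_ext F fun X => ?_
  rw [NatTrans.comp_app, Category.assoc, ranIso_hom_app_comp_counit, hη, unit_fac]

theorem μ_comp_ranIso_hom
    (hμ : ∀ X, T.μ.app (F.obj X) ≫ α.app X = T.map (α.app X) ≫ α.app X) :
    T.μ ≫ (ranIso (T : C ⥤ C) α).hom =
      Functor.whiskerRight (ranIso (T : C ⥤ C) α).hom (T : C ⥤ C) ≫
        Functor.whiskerLeft (ran F) (ranIso (T : C ⥤ C) α).hom ≫ mult F := by
  refine ran_hom_ext F fun X => ?_
  simp only [NatTrans.comp_app, Category.assoc, Functor.whiskerRight_app, Functor.whiskerLeft_app,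
    mult_fac, ranIso_hom_app_comp_counit, hμ, ← NatTrans.naturality_assoc]
  rw [← Functor.map_comp_assoc, ranIso_hom_app_comp_counit]

/-- The isomorphism of monads with the codensity monad of `F`, for a monad `T` that is a right Kan
extension of `F` along itself with a counit `α` whose components satisfy the laws of
a `T`-algebra. -/
def isoCodensityMonad (hη : ∀ X, T.η.app (F.obj X) ≫ α.app X = 𝟙 (F.obj X))
    (hμ : ∀ X, T.μ.app (F.obj X) ≫ α.app X = T.map (α.app X) ≫ α.app X) :
    T ≅ codensityMonad F :=
  MonadIso.mk (N := codensityMonad F) (ranIso (T : C ⥤ C) α)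
    (NatTrans.congr_app (η_comp_ranIso_hom T α hη))
    fun X => (NatTrans.congr_app (μ_comp_ranIso_hom T α hμ) X).trans (Category.assoc _ _ _).symm

end Monad

section InvertibleUnit

theorem μ_app_eq_map_inv_η (T : Monad C) (X : C) [IsIso (T.η.app X)] :
    T.μ.app X = T.map (inv (T.η.app X)) := by
  rw [← cancel_epi (T.map (T.η.app X)), T.right_unit, ← Functor.map_comp, IsIso.hom_inv_id,
    CategoryTheory.Functor.map_id]

variable (F : A ⥤ C) (T : Monad C) [∀ X, IsIso (T.η.app (F.obj X))]

/-- The inverse of `ηF : F ⟶ F ⋙ T`, for a monad `T` whose unit is invertible on the image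
of `F`. -/
def unitInv : F ⋙ (T : C ⥤ C) ⟶ F where
  app X := inv (T.η.app (F.obj X))
  naturality X Y f := by
    rw [IsIso.comp_inv_eq, Category.assoc, IsIso.eq_inv_comp]
    exact (T.η.naturality (F.map f)).symm

/-- The isomorphism with the codensity monad of `F`, for a monad `T` that is a right Kan extension
of `F` along itself with counit inverse to `ηF`. -/
def isoCodensityMonadOfIsIsoUnit [F.HasRightKanExtension F]
    [(T : C ⥤ C).IsRightKanExtension (unitInv F T)] : T ≅ codensityMonad F :=
  isoCodensityMonad T (unitInv F T) (fun _ => IsIso.hom_inv_id _)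
    fun X => congrArg (· ≫ (unitInv F T).app X) (μ_app_eq_map_inv_η T (F.obj X))

end InvertibleUnit

end Recognition

section PrincipalUltrafilters

variable {X : Type u}

theorem evalPoint_injective : Function.Injective (evalPoint X) := by
  classical
  intro x y h
  simpa [evalPoint] using DFunLike.congr_fun h fun z => decide (z = y)

theorem eq_evalPoint_of_apply_singleton [DecidableEq X] {χ : BoundedLatticeHom (X → Bool) Bool}
    {x : X} (hx : χ (fun y => decide (y = x)) = ⊤) : χ = evalPoint X x := by
  refine DFunLike.ext _ _ fun p => ?_
  change χ p = p x
  cases hp : p x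
  · have h_disjoint : p ⊓ (fun y => decide (y = x)) = ⊥ := by
      ext y
      by_cases hy : y = x <;> simp [hy, hp]
    simpa [hx] using congrArg χ h_disjoint
  · have h_le : (fun y => decide (y = x)) ≤ p := by
      intro y hy
      simpa [of_decide_eq_true hy] using hp
    exact top_le_iff.1 (hx ▸ OrderHomClass.mono χ h_le)

theorem evalPoint_surjective [Finite X] : Function.Surjective (evalPoint X) := by
  classical
  intro χ
  have := Fintype.ofFinite X
  have h_cover : Finset.univ.sup (fun x y : X => decide (y = x)) = ⊤ := by
    funext y
    rw [Finset.sup_apply, Pi.top_apply, Finset.sup_eq_top_iff]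
    exact ⟨y, Finset.mem_univ y, decide_eq_true rfl⟩
  have h_sup : Finset.univ.sup (fun x => χ fun y => decide (y = x)) = ⊤ := by
    rw [← map_top χ, ← h_cover, map_finset_sup]
    rfl
  obtain ⟨x, -, hx⟩ := Finset.sup_eq_top_iff.1 h_sup
  exact ⟨x, (eq_evalPoint_of_apply_singleton hx).symm⟩

instance isIso_ultrafilterMonad_η_app (A : FintypeCat.{u}) :
    IsIso (ultrafilterMonad.{u}.η.app (FintypeCat.incl.obj A)) :=
  (isIso_iff_bijective _).2 ⟨evalPoint_injective, evalPoint_surjective (X := A.obj)⟩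

end PrincipalUltrafilters

noncomputable section CompatibleFamilies

/-- A map from `X` to a finite set, as an object of the indexing category of the limit that computes
the right Kan extension at `X`. -/
abbrev arrowOfMap {X A : Type u} [Finite A] (f : X → A) :
    StructuredArrow X FintypeCat.incl.{u} :=
  StructuredArrow.mk (Y := FintypeCat.of A) (↾f)

/-- An element of the limit of the finite sets `A` over all maps `X → A`: a choice of an element
of `A` for every map `X → A`, compatible with postcomposition. -/
abbrev CompatibleFamily (X : Type u) : Type (u + 1) :=
  (StructuredArrow.proj X FintypeCat.incl.{u} ⋙ FintypeCat.incl.{u}).sections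

namespace CompatibleFamily

variable {X : Type u} (s : CompatibleFamily X)

/-- The element of the finite set `A` chosen by a compatible family at a map `f : X → A`. -/
def value {A : Type u} [Finite A] (f : X → A) : A :=
  s.1 (arrowOfMap f)

theorem value_comp {A B : Type u} [Finite A] [Finite B] (h : A → B) (f : X → A) :
    s.value (h ∘ f) = h (s.value f) :=
  let φ : arrowOfMap f ⟶ arrowOfMap (h ∘ f) := StructuredArrow.homMk (FintypeCat.homMk h) rfl
  (s.2 φ).symm

/-- The truth value chosen by a compatible family at a predicate on `X`; the two-element set is
lifted to the universe of `X`. -/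
def boolValue (p : X → Bool) : Bool := (s.value (ULift.up.{u} ∘ p)).down

theorem boolValue_comp {A : Type u} [Finite A] (p : A → Bool) (f : X → A) :
    s.boolValue (p ∘ f) = p (s.value f) :=
  congrArg ULift.down (s.value_comp (ULift.up ∘ p) f)

theorem boolValue_const (b : Bool) : s.boolValue (fun _ => b) = b :=
  s.boolValue_comp (fun _ => b) fun _ => PUnit.unit.{u + 1}

theorem boolValue_map₂ (op : Bool → Bool → Bool) (p q : X → Bool) :
    s.boolValue (fun x => op (p x) (q x)) = op (s.boolValue p) (s.boolValue q) := by
  let pq : X → ULift.{u} (Bool × Bool) := fun x => ULift.up (p x, q x)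
  have hp : s.boolValue p = (s.value pq).down.1 := s.boolValue_comp (Prod.fst ∘ ULift.down) pq
  have hq : s.boolValue q = (s.value pq).down.2 := s.boolValue_comp (Prod.snd ∘ ULift.down) pq
  rw [hp, hq]
  exact s.boolValue_comp (fun t => op t.down.1 t.down.2) pq

/-- The ultrafilter on `X` determined by a compatible family, through its values at predicates. -/
def toUltrafilter : BoundedLatticeHom (X → Bool) Bool where
  toFun := s.boolValue
  map_sup' := s.boolValue_map₂ (· ⊔ ·)
  map_inf' := s.boolValue_map₂ (· ⊓ ·)
  map_top' := s.boolValue_const ⊤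
  map_bot' := s.boolValue_const ⊥

theorem map_toUltrafilter (g : StructuredArrow X FintypeCat.incl.{u}) :
    ultrafilterMonad.{u}.map g.hom s.toUltrafilter = evalPoint g.right.obj (s.1 g) :=
  DFunLike.ext (F := BoundedLatticeHom (g.right.obj → Bool) Bool) _ _ fun p =>
    s.boolValue_comp p g.hom

theorem eq_toUltrafilter {χ : BoundedLatticeHom (X → Bool) Bool}
    (hχ : ∀ g : StructuredArrow X FintypeCat.incl.{u},
      ultrafilterMonad.{u}.map g.hom χ = evalPoint g.right.obj (s.1 g)) :
    χ = s.toUltrafilter := by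
  refine DFunLike.ext _ _ fun p => ?_
  exact DFunLike.congr_fun (F := BoundedLatticeHom (ULift.{u} Bool → Bool) Bool)
    (hχ (arrowOfMap (ULift.up ∘ p))) ULift.down

end CompatibleFamily

/-- The right extension of `FintypeCat.incl` along itself given by the ultrafilter monad, with
counit sending an ultrafilter on a finite set to the point it is concentrated at. -/
abbrev ultrafilterExtension : Functor.RightExtension FintypeCat.incl.{u} FintypeCat.incl.{u} :=
  .mk (ultrafilterMonad.{u} : Type u ⥤ Type u) (unitInv FintypeCat.incl ultrafilterMonad)

theorem ultrafilterExtension_coneAt_π_app_eq_iff {X : Type u}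
    (g : StructuredArrow X FintypeCat.incl.{u}) (χ : BoundedLatticeHom (X → Bool) Bool)
    (a : g.right.obj) :
    (ultrafilterExtension.coneAt X).π.app g χ = a ↔
      ultrafilterMonad.{u}.map g.hom χ = evalPoint g.right.obj a :=
  (asIso (ultrafilterMonad.{u}.η.app (FintypeCat.incl.obj g.right))).toEquiv.symm_apply_eq

/-- The set of ultrafilters on `X` is the limit of the finite sets `A` over all maps `X → A`. -/
def ultrafilterExtensionIsPointwiseRightKanExtension :
    ultrafilterExtension.{u}.IsPointwiseRightKanExtension := fun X =>
  Nonempty.some <| (Limits.Types.isLimit_iff _).2 fun s hs =>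
    let t : CompatibleFamily X := ⟨s, hs⟩
    ⟨t.toUltrafilter,
      fun g => (ultrafilterExtension_coneAt_π_app_eq_iff g _ _).2 (t.map_toUltrafilter g),
      fun _ hχ => t.eq_toUltrafilter fun g =>
        (ultrafilterExtension_coneAt_π_app_eq_iff g _ _).1 (hχ g)⟩

instance isRightKanExtension_ultrafilterMonad :
    (ultrafilterMonad.{u} : Type u ⥤ Type u).IsRightKanExtension
      (unitInv FintypeCat.incl ultrafilterMonad) :=
  ultrafilterExtensionIsPointwiseRightKanExtension.isRightKanExtension

end CompatibleFamilies

end Codensity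

theorem theorem4p1 :
    ∃ _ : FintypeCat.incl.{u}.HasRightKanExtension FintypeCat.incl.{u},
      Nonempty (Functor.RightExtension.mk
        (FintypeCat.incl.{u}.rightKanExtension FintypeCat.incl.{u})
        (FintypeCat.incl.{u}.rightKanExtensionCounit
          FintypeCat.incl.{u})).IsPointwiseRightKanExtension ∧
      Nonempty (Codensity.ultrafilterMonad.{u} ≅
        Codensity.codensityMonad FintypeCat.incl.{u}) := by
  have h := Codensity.ultrafilterExtensionIsPointwiseRightKanExtension.{u}
  have := h.hasPointwiseRightKanExtension
  exact ⟨h.hasRightKanExtension,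
    ⟨Functor.isPointwiseRightKanExtensionOfIsRightKanExtension _ _⟩,
    ⟨Codensity.isoCodensityMonadOfIsIsoUnit FintypeCat.incl Codensity.ultrafilterMonad⟩⟩
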